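/- **Asymptotics of the $N$-dark/anti-dark soliton.** Consider the coupled Fokas–Lenells equation $$u_{1,xt}+u_1+\mathrm i(|u_1|^2+\tfrac12\sigma|u_2|^2)u_{1,x}+\tfrac{\mathrm i}{2}\sigma u_1u_2^*u_{2,x}=0,\qquad u_{2,xt}+u_2+\mathrm i(\sigma|u_2|^2+\tfrac12|u_1|^2)u_{2,x}+\tfrac{\mathrm i}{2}u_2u_1^*u_{1,x}=0,$$ $\sigma=\pm1$, with plane wave background $a_s\mathrm e^{\mathrm i\omega_s}$, $s=1,2$, where $a_1,a_2\in\mathbb R$, $b_1,b_2\in\mathbb R\setminus\{0\}$ and $$\omega_1=b_1x-\tfrac12\Bigl(2a_1^2+\sigma a_2^2-\tfrac2{b_1}+\sigma a_2^2\tfrac{b_2}{b_1}\Bigr)t,\qquad \omega_2=b_2x-\tfrac12\Bigl(2\sigma a_2^2+a_1^2-\tfrac2{b_2}+a_1^2\tfrac{b_1}{b_2}\Bigr)t .$$ Let $N\ge1$. For $1\le i\le N$ let $\lambda_i\in(\mathbb R\cup\mathrm i\mathbb R)\setminus\{0\}$, $z_i=\lambda_i^{-2}$, $\varsigma_i\in\{1,-1\}$,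 and let $\kappa_i$ be a non-real root of $$(z_i^{-1}\kappa-2)(\kappa+b_1)(\kappa+b_2)+a_1^2b_1^2(\kappa+b_2)+\sigma a_2^2b_2^2(\kappa+b_1)=0 .$$ Put $$\vartheta_i=\mathrm i(\kappa_i-z_i)\Bigl(x+\frac{\kappa_i-z_i+b_1+b_2}{2b_1b_2z_i}\,t\Bigr),\qquad v_i=-\frac1{b_1b_2z_i}\Bigl(\mathrm{Re}\,\kappa_i-z_i+\frac{b_1+b_2}2\Bigr),$$ so that $\mathrm{Re}\,\vartheta_i=-\mathrm{Im}\,\kappa_i\,(x-v_it)$, and let $u_s[N]=a_s\frac{\det H_s}{\det M}\mathrm e^{\mathrm i\omega_s}$ with the $N\times N$ matrices $$M_{ij}=\frac{2\lambda_j^{-1}}{\kappa_j-\kappa_i^*}\bigl[\kappa_i^*\mathrm e^{\vartheta_i+\vartheta_i^*}+\delta_{ij}\varsigma_i|\kappa_i|\bigr],\qquad (H_s)_{ij}=\frac{2\lambda_j^{-1}}{\kappa_j-\kappa_i^*}\Bigl[\frac{\kappa_i^*+b_s}{\kappa_j+b_s}\kappa_j\mathrm e^{\vartheta_i+\vartheta_i^*}+\delta_{ij}\varsigma_i|\kappa_i|\Bigr].$$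 Assume that either $\mathrm{Im}\,\kappa_i>0$ for all $i$ and $v_1<v_2<\dots<v_N$, or $\mathrm{Im}\,\kappa_i<0$ for all $i$ and $v_1>v_2>\dots>v_N$. Then, as $t\to\pm\infty$, $\det M\neq0$ for all $x\in\mathbb R$ once $|t|$ is large enough, and, uniformly in $x\in\mathbb R$, $$u_s[N]=a_s\Bigl[S_1^{[s]\pm}+\bigl(S_2^{[s]\pm}-A_1^{[s]\pm}\bigr)+\dots+\bigl(S_N^{[s]\pm}-A_{N-1}^{[s]\pm}\bigr)\Bigr]\mathrm e^{\mathrm i\omega_s}+O(\mathrm e^{-c|t|}),\qquad c=\min_i|\mathrm{Im}\,\kappa_i|\,\min_{i\ne j}|v_i-v_j|>0$$ (for $N=1$, where the second minimum is over the empty set, $c$ may be any real number), where $$S_k^{[s]\pm}=P_k^{[s]\pm}\,\frac{\kappa_k\exp(2\mathrm{Re}\,\vartheta_k^\pm+\mathrm i\tau_k^{[s]})+\varsigma_k|\kappa_k|}{\kappa_k^*\exp(2\mathrm{Re}\,\vartheta_k^\pm)+\varsigma_k|\kappa_k|},\qquad \mathrm e^{\mathrm i\tau_k^{[s]}}=\frac{\kappa_k^*+b_s}{\kappa_k+b_s},$$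 $$P_k^{[s]-}=\prod_{i=1}^{k-1}\frac{(\kappa_i^*+b_s)\kappa_i}{(\kappa_i+b_s)\kappa_i^*},\quad P_k^{[s]+}=\prod_{i=k+1}^{N}\frac{(\kappa_i^*+b_s)\kappa_i}{(\kappa_i+b_s)\kappa_i^*},\quad A_i^{[s]-}=P_i^{[s]-}\mathrm e^{\mathrm i\tau_i^{[s]}}\frac{\kappa_i}{\kappa_i^*},\quad A_i^{[s]+}=P_i^{[s]+},$$ $$\vartheta_k^-=\vartheta_k+\sum_{i=1}^{k-1}\ln\left|\frac{\kappa_k-\kappa_i}{\kappa_k^*-\kappa_i}\right|,\qquad \vartheta_k^+=\vartheta_k+\sum_{i=k+1}^{N}\ln\left|\frac{\kappa_k-\kappa_i}{\kappa_k^*-\kappa_i}\right| .$$ Moreover the Cauchy determinants $\Delta_k=\det\bigl(\frac1{\kappa_j-\kappa_i^*}\bigr)_{1\le i,j\le k}$ ($\Delta_0=1$) do not vanish and satisfy, for $1\le k\le N$, $$\frac{\Delta_k}{\Delta_{k-1}}=\frac1{\kappa_k-\kappa_k^*}\prod_{i=1}^{k-1}\left|\frac{\kappa_k-\kappa_i}{\kappa_k^*-\kappa_i}\right|^2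 .$$ -/

import Mathlib

open scoped ComplexConjugate

noncomputable section

/-- The number `z = λ⁻²` attached to a spectral parameter `λ ∈ ℝ ∪ iℝ`, as a real number
(see `DarkSolitonData.coe_z`). -/
def spectralZ (lam : ℂ) : ℝ := (1 / lam ^ 2).re

/-- The parameters of an `N`-dark/anti-dark soliton of the coupled Fokas-Lenells equation
on the plane wave background. The two components `s = 1, 2` are indexed by `Fin 2`. -/
structure DarkSolitonData (N : ℕ) where
  /-- the sign in the equation -/
  sig : ℝ
  /-- amplitudes of the background -/
  a : Fin 2 → ℝ
  /-- wave numbers of the background -/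
  b : Fin 2 → ℝ
  /-- spectral parameters -/
  lam : Fin N → ℂ
  /-- the chosen root of the characteristic equation, one for each spectral parameter -/
  κ : Fin N → ℂ
  /-- signs `ς_i` -/
  sgn : Fin N → ℝ
  sig_eq : sig = 1 ∨ sig = -1
  b_ne : ∀ s, b s ≠ 0
  lam_ne : ∀ i, lam i ≠ 0
  lam_axis : ∀ i, (lam i).im = 0 ∨ (lam i).re = 0
  sgn_eq : ∀ i, sgn i = 1 ∨ sgn i = -1
  κ_im_ne : ∀ i, (κ i).im ≠ 0
  char_eq : ∀ i, (κ i / (spectralZ (lam i) : ℂ) - 2) * (κ i + b 0) * (κ i + b 1)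
      + (a 0 : ℂ) ^ 2 * (b 0 : ℂ) ^ 2 * (κ i + b 1)
      + (sig : ℂ) * (a 1 : ℂ) ^ 2 * (b 1 : ℂ) ^ 2 * (κ i + b 0) = 0

namespace DarkSolitonData

variable {N : ℕ} (p : DarkSolitonData N)

/-- `z_i = λ_i⁻²`, a nonzero real number. -/
def z (i : Fin N) : ℝ := spectralZ (p.lam i)

theorem coe_z (i : Fin N) : (p.z i : ℂ) = 1 / p.lam i ^ 2 := by
  apply Complex.ext
  · rw [Complex.ofReal_re]
    rfl
  · have h : (p.lam i ^ 2).im = 0 := by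
      rcases p.lam_axis i with h | h <;> simp [pow_two, h]
    rw [one_div, Complex.inv_im, h]
    simp

/-- The phases `ω_1`, `ω_2` of the plane wave background. -/
def omega (s : Fin 2) (x t : ℝ) : ℝ :=
  ![p.b 0 * x - 1 / 2 * (2 * p.a 0 ^ 2 + p.sig * p.a 1 ^ 2 - 2 / p.b 0
        + p.sig * p.a 1 ^ 2 * (p.b 1 / p.b 0)) * t,
    p.b 1 * x - 1 / 2 * (2 * p.sig * p.a 1 ^ 2 + p.a 0 ^ 2 - 2 / p.b 1
        + p.a 0 ^ 2 * (p.b 0 / p.b 1)) * t] s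

/-- `ϑ_i = i (κ_i - z_i) (x + (κ_i - z_i + b_1 + b_2) t / (2 b_1 b_2 z_i))`. -/
def theta (i : Fin N) (x t : ℝ) : ℂ :=
  Complex.I * (p.κ i - p.z i) *
    (x + 1 / (2 * p.b 0 * p.b 1 * p.z i) * (p.κ i - p.z i + p.b 0 + p.b 1) * t)

/-- The velocity `v_i` of the `i`-th soliton: `Re ϑ_i = - Im κ_i * (x - v_i t)`. -/
def velocity (i : Fin N) : ℝ :=
  -(1 / (p.b 0 * p.b 1 * p.z i)) * ((p.κ i).re - p.z i + (p.b 0 + p.b 1) / 2)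

/-- The matrix `M` in the denominator. -/
def M (x t : ℝ) : Matrix (Fin N) (Fin N) ℂ := Matrix.of fun i j =>
  2 * (p.lam j)⁻¹ / (p.κ j - conj (p.κ i)) *
    (conj (p.κ i) * Complex.exp (p.theta i x t + conj (p.theta i x t))
      + if i = j then (p.sgn i : ℂ) * (‖p.κ i‖ : ℂ) else 0)

/-- The matrix `H_s` in the numerator. -/
def H (s : Fin 2) (x t : ℝ) : Matrix (Fin N) (Fin N) ℂ := Matrix.of fun i j =>
  2 * (p.lam j)⁻¹ / (p.κ j - conj (p.κ i)) *
    ((conj (p.κ i) + p.b s) / (p.κ j + p.b s) * p.κ j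
        * Complex.exp (p.theta i x t + conj (p.theta i x t))
      + if i = j then (p.sgn i : ℂ) * (‖p.κ i‖ : ℂ) else 0)

/-- The `N`-dark/anti-dark soliton `u_s[N] = a_s (det H_s / det M) exp (i ω_s)`. -/
def u (s : Fin 2) (x t : ℝ) : ℂ :=
  p.a s * ((p.H s x t).det / (p.M x t).det) * Complex.exp (Complex.I * p.omega s x t)

/-- `exp (i τ_k^{[s]}) = (κ_k^* + b_s) / (κ_k + b_s)`. -/
def expTau (s : Fin 2) (k : Fin N) : ℂ := (conj (p.κ k) + p.b s) / (p.κ k + p.b s)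

/-- `P_k^{[s]-}`, the product over `i < k`. -/
def PMinus (s : Fin 2) (k : Fin N) : ℂ :=
  ∏ i ∈ Finset.Iio k,
    ((conj (p.κ i) + p.b s) * p.κ i) / ((p.κ i + p.b s) * conj (p.κ i))

/-- `P_k^{[s]+}`, the product over `i > k`. -/
def PPlus (s : Fin 2) (k : Fin N) : ℂ :=
  ∏ i ∈ Finset.Ioi k,
    ((conj (p.κ i) + p.b s) * p.κ i) / ((p.κ i + p.b s) * conj (p.κ i))

/-- `ϑ_k^-`. -/
def thetaMinus (k : Fin N) (x t : ℝ) : ℂ :=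
  p.theta k x t
    + ∑ i ∈ Finset.Iio k, (Real.log ‖(p.κ k - p.κ i) / (conj (p.κ k) - p.κ i)‖ : ℂ)

/-- `ϑ_k^+`. -/
def thetaPlus (k : Fin N) (x t : ℝ) : ℂ :=
  p.theta k x t
    + ∑ i ∈ Finset.Ioi k, (Real.log ‖(p.κ k - p.κ i) / (conj (p.κ k) - p.κ i)‖ : ℂ)

/-- The profile of a single dark/anti-dark soliton with phase `θ`:
`(κ_k exp (2 Re θ + i τ_k) + ς_k |κ_k|) / (κ_k^* exp (2 Re θ) + ς_k |κ_k|)`. -/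
def profile (s : Fin 2) (k : Fin N) (θ : ℂ) : ℂ :=
  (p.κ k * ((Real.exp (2 * θ.re) : ℂ) * p.expTau s k) + (p.sgn k : ℂ) * (‖p.κ k‖ : ℂ)) /
    (conj (p.κ k) * (Real.exp (2 * θ.re) : ℂ) + (p.sgn k : ℂ) * (‖p.κ k‖ : ℂ))

/-- `S_k^{[s]-}`. -/
def SMinus (s : Fin 2) (k : Fin N) (x t : ℝ) : ℂ :=
  p.PMinus s k * p.profile s k (p.thetaMinus k x t)

/-- `S_k^{[s]+}`. -/
def SPlus (s : Fin 2) (k : Fin N) (x t : ℝ) : ℂ :=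
  p.PPlus s k * p.profile s k (p.thetaPlus k x t)

/-- `A_i^{[s]-}`. -/
def AMinus (s : Fin 2) (i : Fin N) : ℂ :=
  p.PMinus s i * p.expTau s i * (p.κ i / conj (p.κ i))

/-- `A_i^{[s]+}`. -/
def APlus (s : Fin 2) (i : Fin N) : ℂ := p.PPlus s i

/-- `c = min_i |Im κ_i| * min_{i ≠ j} |v_i - v_j|` (meant for `N ≥ 2`, where both are minima over
nonempty finite sets). -/
def decayRate : ℝ :=
  (⨅ i, |(p.κ i).im|) *
    ⨅ q : {q : Fin N × Fin N // q.1 ≠ q.2}, |p.velocity q.1.1 - p.velocity q.1.2|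

/-- The Cauchy determinant `Δ_k`, formed with `κ_1, …, κ_k`. -/
def cauchyDet (k : ℕ) (hk : k ≤ N) : ℂ :=
  Matrix.det (Matrix.of fun i j : Fin k =>
    1 / (p.κ (Fin.castLE hk j) - conj (p.κ (Fin.castLE hk i))))

end DarkSolitonData

namespace DarkSolitonData

variable {n : ℕ} (p : DarkSolitonData (n + 1))

/-- `a_s [S_1^- + (S_2^- - A_1^-) + ⋯ + (S_N^- - A_{N-1}^-)] exp (i ω_s)`, where `N = n + 1`. -/
def approxMinus (s : Fin 2) (x t : ℝ) : ℂ :=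
  p.a s * (p.SMinus s 0 x t + ∑ k : Fin n, (p.SMinus s k.succ x t - p.AMinus s k.castSucc))
    * Complex.exp (Complex.I * p.omega s x t)

/-- `a_s [S_1^+ + (S_2^+ - A_1^+) + ⋯ + (S_N^+ - A_{N-1}^+)] exp (i ω_s)`, where `N = n + 1`. -/
def approxPlus (s : Fin 2) (x t : ℝ) : ℂ :=
  p.a s * (p.SPlus s 0 x t + ∑ k : Fin n, (p.SPlus s k.succ x t - p.APlus s k.castSucc))
    * Complex.exp (Complex.I * p.omega s x t)

end DarkSolitonData

end

/-! Up to the common factor `∏ 2/λ_j`, both `det M` and `det H_s` are sums over subsets `S` of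
`∏_{i∈S} α_i y_i ∏_{i∉S} d_i · Δ_S`. Here `y_i = exp (2 Re ϑ_i)`, `Δ_S` is a principal minor of the
Cauchy matrix `1/(κ_j - κ_i^*)`, and the `d_i` are shared; only `α_i` differs: `κ_i^*` for `M`,
`e^{iτ_i} κ_i` for `H_s`.

Given `(x, t)`, let `k` be the soliton whose centre `v_k t` is nearest to `x`. Every other centre is
at distance at least `|v_i - v_k||t|/2`, so each `y_i`, `i ≠ k`, is at least `e^{c|t|}` or at most
`e^{-c|t|}`. The ordering of the velocities puts the large ones at `i < k` for `t < 0` and at `i >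
k` for `t > 0` (`exists_separated`). With `B` the set of large indices, only `S = B` and `S = B ∪
{k}` survive (`exists_subsetSum_div_approx`). Their quotient is the profile of soliton `k`, with
phase shift `Δ_{B∪{k}}/Δ_B`, which a Schur complement evaluates
(`principalMinor_cauchyMatrix_insert`).

All other solitons are then near their limiting values, so the claimed superposition telescopes to
`S_k` up to the same error (`norm_telescope_sub_le`). Uniformity in `x` holds because `k` ranges
over a finite set and the constants do not depend on `y_k`. -/

/-! ### Determinants expanded in principal minors. -/

section MinorExpansion

/-- The principal minor of `C` on the rows and columns in `S`. -/
def principalMinor {ι R : Type*} [DecidableEq ι] [CommRing R] (C : Matrix ι ι R)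
    (S : Finset ι) : R :=
  (C.submatrix (Subtype.val : S → ι) Subtype.val).det

theorem principalMinor_mul_row {ι R : Type*} [DecidableEq ι] [CommRing R] (C : Matrix ι ι R)
    (c : ι → R) (S : Finset ι) :
    principalMinor (Matrix.of fun i j => c j * C i j) S = (∏ i ∈ S, c i) * principalMinor C S := by
  rw [principalMinor, principalMinor, ← Finset.prod_coe_sort, ← Matrix.det_mul_row]
  rfl

variable {ι R : Type*} [Fintype ι] [DecidableEq ι] [CommRing R]

/-- Rows outside `S` are rows of the identity, so the matrix is block triangular and the
complementary block has determinant one. -/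
theorem det_ite_one (C : Matrix ι ι R) (S : Finset ι) :
    Matrix.det (Matrix.of fun i j => if i ∈ S then C i j else (1 : Matrix ι ι R) i j) =
      principalMinor C S := by
  rw [Matrix.twoBlockTriangular_det _ (fun i => i ∈ S)]
  · have h1 : (Matrix.toSquareBlockProp
        (Matrix.of fun i j => if i ∈ S then C i j else (1 : Matrix ι ι R) i j)
        fun i => i ∉ S) = 1 := by
      ext i j
      simp [Matrix.toSquareBlockProp, i.2, Matrix.one_apply, Subtype.ext_iff]
    have h2 : (Matrix.toSquareBlockProp
        (Matrix.of fun i j => if i ∈ S then C i j else (1 : Matrix ι ι R) i j)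
        fun i => i ∈ S) = C.submatrix (Subtype.val : {i // i ∈ S} → ι) Subtype.val := by
      ext i j
      simp [Matrix.toSquareBlockProp]
    rw [h1, h2, Matrix.det_one, mul_one, principalMinor]
    congr!
  · intro i hi j hj
    have : i ≠ j := fun h => hi (h ▸ hj)
    simp [hi, this]

/-- Expansion of `det (diag w * C + diag d)` in principal minors of `C`. -/
theorem det_row_mul_add_diagonal (C : Matrix ι ι R) (w d : ι → R) :
    Matrix.det (Matrix.of fun i j => w i * C i j + if i = j then d i else 0) =
      ∑ S : Finset ι, (∏ i, S.piecewise w d i) * principalMinor C S := by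
  have h : (Matrix.of fun i j => w i * C i j + if i = j then d i else 0) =
      (fun i => w i • C i) + fun i => d i • (1 : Matrix ι ι R) i := by
    ext i j
    simp [Matrix.one_apply]
  -- Multilinearity in the rows: `S` records which rows are taken from `diag w * C`.
  have key := (Matrix.detRowAlternating (n := ι) (R := R)).map_add_univ
    (fun i => w i • C i) (fun i => d i • (1 : Matrix ι ι R) i)
  rw [h]
  refine key.trans (Finset.sum_congr rfl fun S _ => ?_)
  rw [← det_ite_one, ← Matrix.det_mul_column]
  change Matrix.det _ = Matrix.det _
  congr 1
  ext i j
  by_cases hi : i ∈ S <;> simp [hi]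

/-- Expansion of `det (diag w * C * diag c + diag d)` in principal minors of `C`. -/
theorem det_row_col_mul_add_diagonal (C : Matrix ι ι R) (w c d : ι → R) :
    Matrix.det (Matrix.of fun i j => w i * (c j * C i j) + if i = j then d i else 0) =
      ∑ S : Finset ι, (∏ i, S.piecewise (fun i => w i * c i) d i) * principalMinor C S := by
  refine (det_row_mul_add_diagonal (Matrix.of fun i j => c j * C i j) w d).trans
    (Finset.sum_congr rfl fun S _ => ?_)
  rw [principalMinor_mul_row, ← mul_assoc]
  congr 1
  have h : ∏ i ∈ S, c i = ∏ i, S.piecewise c 1 i := by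
    rw [Finset.prod_piecewise]
    simp
  rw [h, ← Finset.prod_mul_distrib]
  refine Finset.prod_congr rfl fun i _ => ?_
  by_cases hi : i ∈ S <;> simp [hi]

end MinorExpansion

/-! ### Principal minors of Cauchy matrices. -/

section Cauchy

variable {ι F : Type*} [DecidableEq ι] [Field F]

/-- The Cauchy matrix with entries `1 / (x_j - y_i)`. -/
def cauchyMatrix (x y : ι → F) : Matrix ι ι F := Matrix.of fun i j => 1 / (x j - y i)

/-- Adjoining one index to a principal minor of a Cauchy matrix. -/
theorem principalMinor_cauchyMatrix_insert {x y : ι → F} (hxy : ∀ i j, x j - y i ≠ 0)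
    {k : ι} {S : Finset ι} (hk : k ∉ S) :
    principalMinor (cauchyMatrix x y) (insert k S) =
      principalMinor (cauchyMatrix x y) S * (1 / (x k - y k) *
        ∏ i ∈ S, (x i - x k) * (y k - y i) / ((x i - y k) * (x k - y i))) := by
  let e : S ⊕ PUnit.{1} ≃ (insert k S : Finset ι) :=
    (Equiv.optionEquivSumPUnit S).symm.trans (Finset.subtypeInsertEquivOption hk).symm
  have e1 : ∀ i : S, (e (Sum.inl i) : ι) = i := fun i => rfl
  have e2 : ∀ i : PUnit.{1}, (e (Sum.inr i) : ι) = k := fun i => rfl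
  have hD : IsUnit (Matrix.of fun _ _ : PUnit.{1} => 1 / (x k - y k)).det := by
    simp [hxy]
  let := Matrix.invertibleOfIsUnitDet _ hD
  have hinv : ⅟(Matrix.of fun _ _ : PUnit.{1} => 1 / (x k - y k)) =
      Matrix.of fun _ _ : PUnit.{1} => x k - y k := by
    apply invOf_eq_right_inv
    ext i j
    simp [Matrix.mul_apply, hxy k k]
  have hblock : ((cauchyMatrix x y).submatrix (Subtype.val : ↥(insert k S : Finset ι) → ι)
        Subtype.val).submatrix e e =
      Matrix.fromBlocks ((cauchyMatrix x y).submatrix (Subtype.val : S → ι) Subtype.val)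
        (Matrix.of fun (i : S) (_ : PUnit.{1}) => 1 / (x k - y i))
        (Matrix.of fun (_ : PUnit.{1}) (j : S) => 1 / (x j - y k))
        (Matrix.of fun _ _ : PUnit.{1} => 1 / (x k - y k)) := by
    ext (i | i) (j | j) <;> simp [cauchyMatrix, e1, e2]
  rw [principalMinor, ← Matrix.det_submatrix_equiv_self e, hblock, Matrix.det_fromBlocks₂₂, hinv]
  -- The Schur complement of the `(k, k)` entry is the same Cauchy matrix with rows and columns
  -- rescaled, so its determinant is the old minor times the scaling factors.
  have hschur : (cauchyMatrix x y).submatrix (Subtype.val : S → ι) Subtype.val -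
      (Matrix.of fun (i : S) (_ : PUnit.{1}) => 1 / (x k - y i)) *
        (Matrix.of fun _ _ : PUnit.{1} => x k - y k) *
        (Matrix.of fun (_ : PUnit.{1}) (j : S) => 1 / (x j - y k)) =
      Matrix.of fun i j : S => ((y k - y i) / (x k - y i)) *
        (Matrix.of fun i j : S => ((x j - x k) / (x j - y k)) *
          (cauchyMatrix x y).submatrix (Subtype.val : S → ι) Subtype.val i j) i j := by
    ext i j
    have h1 := hxy i j
    have h2 := hxy i k
    have h3 := hxy k j
    simp only [cauchyMatrix, Matrix.sub_apply, Matrix.submatrix_apply, Matrix.of_apply,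
      Matrix.mul_apply, Finset.univ_unique, Finset.sum_singleton]
    field_simp
    ring
  rw [hschur, Matrix.det_mul_column, Matrix.det_mul_row, ← mul_assoc (∏ i, _),
    ← Finset.prod_mul_distrib, principalMinor,
    ← Finset.prod_coe_sort S fun i => (x i - x k) * (y k - y i) / ((x i - y k) * (x k - y i))]
  have : ∀ i : S, (y k - y i) / (x k - y i) * ((x i - x k) / (x i - y k)) =
      (x i - x k) * (y k - y i) / ((x i - y k) * (x k - y i)) := fun i => by
    rw [div_mul_div_comm, mul_comm (y k - y i), mul_comm (x k - y i)]
  simp only [this, Matrix.det_unique, Matrix.of_apply]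
  ac_rfl

theorem principalMinor_cauchyMatrix_ne_zero {x y : ι → F} (hxy : ∀ i j, x j - y i ≠ 0)
    (hx : Function.Injective x) (hy : Function.Injective y) (S : Finset ι) :
    principalMinor (cauchyMatrix x y) S ≠ 0 := by
  induction S using Finset.induction_on with
  | empty => simp [principalMinor]
  | insert k S hk ih =>
    rw [principalMinor_cauchyMatrix_insert hxy hk]
    refine mul_ne_zero ih (mul_ne_zero (one_div_ne_zero (hxy k k))
      (Finset.prod_ne_zero_iff.2 fun i hi => ?_))
    have hik : i ≠ k := fun h => hk (h ▸ hi)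
    exact div_ne_zero (mul_ne_zero (sub_ne_zero.2 (hx.ne hik)) (sub_ne_zero.2 (hy.ne hik.symm)))
      (mul_ne_zero (hxy _ _) (hxy _ _))

end Cauchy

/-! ### Dominant terms of subset sums. -/

section DominantMinors

variable {ι : Type*} [Fintype ι] [DecidableEq ι]

/-- Weighted sum over subsets, the shape of the minor expansion of a determinant. -/
def subsetSum (g : Finset ι → ℂ) (w d : ι → ℂ) : ℂ :=
  ∑ S : Finset ι, (∏ i, S.piecewise w d i) * g S

/-- The variables `y i` are at least `1 / ε` for `i ∈ B` and at most `ε` for the other `i ≠ k`. -/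
def Separated (B : Finset ι) (k : ι) (ε : ℝ) (y : ι → ℝ) : Prop :=
  ∀ i, 0 < y i ∧ (i ≠ k → if i ∈ B then (y i)⁻¹ ≤ ε else y i ≤ ε)

theorem prod_piecewise_le {s t : ι → ℝ} (hs : ∀ i, 0 ≤ s i) (ht : ∀ i, 0 ≤ t i)
    (hst : ∀ i, s i + t i = 1) (S : Finset ι) (j : ι) {ε : ℝ}
    (hj : S.piecewise s t j ≤ ε) : ∏ i, S.piecewise s t i ≤ ε := by
  have h0 : ∀ i, 0 ≤ S.piecewise s t i := fun i => by
    by_cases hi : i ∈ S <;> simp [hi, hs, ht]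
  have h1 : ∀ i, S.piecewise s t i ≤ 1 := fun i => by
    by_cases hi : i ∈ S <;> simp [hi] <;> linarith [hs i, ht i, hst i]
  rw [← Finset.mul_prod_erase _ _ (Finset.mem_univ j)]
  calc _ ≤ S.piecewise s t j * 1 :=
        mul_le_mul_of_nonneg_left (Finset.prod_le_one (fun i _ => h0 i) fun i _ => h1 i) (h0 j)
    _ ≤ ε := by linarith

theorem prod_piecewise_mul {ι : Type*} [DecidableEq ι] (S : Finset ι) (T : Finset ι) (a b c d : ι → ℂ) :
    ∏ i ∈ T, S.piecewise (fun i => a i * b i) (fun i => c i * d i) i =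
      (∏ i ∈ T, S.piecewise a c i) * ∏ i ∈ T, S.piecewise b d i := by
  rw [← Finset.prod_mul_distrib]
  refine Finset.prod_congr rfl fun i _ => ?_
  by_cases hi : i ∈ S <;> simp [hi]

/-- In the normalised variables `s = y / (1 + y)`, `t = 1 / (1 + y)` all subsets except
`B` and `insert k B` contribute `O(ε)`. -/
theorem exists_subsetSum_approx (g : Finset ι → ℂ) (α d : ι → ℂ) {B : Finset ι} {k : ι}
    (hk : k ∉ B) :
    ∃ K : ℝ, 0 ≤ K ∧ ∀ (ε : ℝ) (s t : ι → ℝ), 0 ≤ ε → (∀ i, 0 ≤ s i) → (∀ i, 0 ≤ t i) →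
      (∀ i, s i + t i = 1) → (∀ i, i ≠ k → if i ∈ B then t i ≤ ε else s i ≤ ε) →
      ‖subsetSum g (fun i => α i * s i) (fun i => d i * t i) -
        (∏ i ∈ Finset.univ.erase k, B.piecewise (fun i => (s i : ℂ)) (fun i => (t i : ℂ)) i) *
        ((∏ i ∈ Finset.univ.erase k, B.piecewise α d i) *
          (g B * (d k * t k) + g (insert k B) * (α k * s k)))‖ ≤ K * ε := by
  refine ⟨∑ S : Finset ι, ‖∏ i, S.piecewise α d i‖ * ‖g S‖,
    Finset.sum_nonneg fun S _ => by positivity, fun ε s t hε0 hs ht hst hε => ?_⟩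
  have hBk : B ≠ insert k B := fun h => hk (h ▸ Finset.mem_insert_self k B)
  set f : Finset ι → ℂ := fun S =>
    (∏ i, S.piecewise (fun i => α i * (s i : ℂ)) (fun i => d i * (t i : ℂ)) i) * g S with hf
  have hsplit : subsetSum g (fun i => α i * s i) (fun i => d i * t i) =
      f B + f (insert k B) + ∑ S ∈ (Finset.univ.erase B).erase (insert k B), f S := by
    rw [subsetSum, ← Finset.add_sum_erase _ _ (Finset.mem_univ B),
      ← Finset.add_sum_erase (Finset.univ.erase B) _
        (Finset.mem_erase.2 ⟨hBk.symm, Finset.mem_univ _⟩), ← add_assoc]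
  have hmain : f B + f (insert k B) =
      (∏ i ∈ Finset.univ.erase k, B.piecewise (fun i => (s i : ℂ)) (fun i => (t i : ℂ)) i) *
        ((∏ i ∈ Finset.univ.erase k, B.piecewise α d i) *
          (g B * (d k * t k) + g (insert k B) * (α k * s k))) := by
    have hins : ∏ i ∈ Finset.univ.erase k, (insert k B).piecewise (fun i => α i * (s i : ℂ))
        (fun i => d i * (t i : ℂ)) i = ∏ i ∈ Finset.univ.erase k,
        B.piecewise (fun i => α i * (s i : ℂ)) (fun i => d i * (t i : ℂ)) i := by
      refine Finset.prod_congr rfl fun i hi => ?_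
      by_cases hiB : i ∈ B <;> simp [hiB, Finset.ne_of_mem_erase hi]
    simp only [hf]
    rw [← Finset.mul_prod_erase _ _ (Finset.mem_univ k),
      ← Finset.mul_prod_erase _ ((insert k B).piecewise _ _) (Finset.mem_univ k), hins,
      prod_piecewise_mul, Finset.piecewise_eq_of_notMem _ _ _ hk,
      Finset.piecewise_eq_of_mem _ _ _ (Finset.mem_insert_self k B)]
    ring
  rw [hsplit, ← hmain, add_sub_cancel_left, Finset.sum_mul]
  have hterm : ∀ S ∈ (Finset.univ.erase B).erase (insert k B),
      ‖f S‖ ≤ ‖∏ i, S.piecewise α d i‖ * ‖g S‖ * ε := by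
    intro S hS
    have hS1 : S ≠ insert k B := Finset.ne_of_mem_erase hS
    have hS2 : S ≠ B := Finset.ne_of_mem_erase (Finset.mem_of_mem_erase hS)
    have hnorm : ‖∏ i, S.piecewise (fun i => (s i : ℂ)) (fun i => (t i : ℂ)) i‖ =
        ∏ i, S.piecewise s t i := by
      rw [norm_prod]
      refine Finset.prod_congr rfl fun i _ => ?_
      by_cases hi : i ∈ S <;> simp [hi, abs_of_nonneg, hs, ht]
    -- A subset other than `B` and `insert k B` disagrees with `B` at some `j ≠ k`, and there it
    -- picks up the factor of size at most `ε`.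
    obtain ⟨j, hjk, hj⟩ : ∃ j, j ≠ k ∧ ¬(j ∈ S ↔ j ∈ B) := by
      by_contra! hcon
      by_cases hkS : k ∈ S
      · exact hS1 (by ext i; by_cases hik : i = k <;> simp [hik, hkS, hcon i])
      · exact hS2 (by ext i; by_cases hik : i = k <;> simp [hik, hkS, hk, hcon i])
    have hle : ∏ i, S.piecewise s t i ≤ ε := by
      refine prod_piecewise_le hs ht hst S j ?_
      have := hε j hjk
      by_cases h1 : j ∈ S <;> by_cases h2 : j ∈ B <;> simp_all
    simp only [hf]
    rw [prod_piecewise_mul, norm_mul, norm_mul, hnorm, mul_right_comm]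
    gcongr
  refine (norm_sum_le _ _).trans ((Finset.sum_le_sum hterm).trans ?_)
  exact Finset.sum_le_sum_of_subset_of_nonneg (Finset.subset_univ _) fun S' _ _ => by positivity

theorem norm_div_sub_div_le {a b a' b' : ℂ} {A b₀ δ η : ℝ} (hb₀ : 0 < b₀) (hb : b₀ ≤ ‖b‖)
    (ha : ‖a‖ ≤ A) (haa : ‖a' - a‖ ≤ δ) (hbb : ‖b' - b‖ ≤ η) (hη : η ≤ b₀ / 2) :
    b' ≠ 0 ∧ ‖a' / b' - a / b‖ ≤ (δ + A / b₀ * η) / (b₀ / 2) := by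
  have hb' : b₀ / 2 ≤ ‖b'‖ := by
    have := norm_sub_norm_le b b'
    rw [norm_sub_rev] at this
    linarith
  have hb0 : b ≠ 0 := norm_pos_iff.1 (hb₀.trans_le hb)
  have hb0' : b' ≠ 0 := norm_pos_iff.1 ((half_pos hb₀).trans_le hb')
  refine ⟨hb0', ?_⟩
  have h : a' / b' - a / b = ((a' - a) - a / b * (b' - b)) / b' := by
    field_simp
    ring
  rw [h, norm_div]
  have hab : ‖a / b‖ ≤ A / b₀ := by
    rw [norm_div]
    exact div_le_div₀ ((norm_nonneg a).trans ha) ha hb₀ hb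
  have hA : 0 ≤ A / b₀ := (norm_nonneg _).trans hab
  have hnum : ‖(a' - a) - a / b * (b' - b)‖ ≤ δ + A / b₀ * η := by
    refine (norm_sub_le _ _).trans (add_le_add haa ?_)
    rw [norm_mul]
    exact mul_le_mul hab hbb (norm_nonneg _) hA
  exact div_le_div₀ ((norm_nonneg _).trans hnum) hnum (half_pos hb₀) hb'

/-- Dividing by `∏ (1 + y i)` makes all weights bounded. The factor cancels in quotients of two such
sums, so estimates become uniform in the unrestricted variable `y k`. -/
theorem subsetSum_normalize (g : Finset ι → ℂ) (α d : ι → ℂ) {y : ι → ℝ} (hy : ∀ i, 0 < y i) :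
    subsetSum g (fun i => α i * y i) d = (∏ i, (1 + y i : ℂ)) *
      subsetSum g (fun i => α i * (y i / (1 + y i) : ℝ)) (fun i => d i * (1 / (1 + y i) : ℝ)) := by
  rw [subsetSum, subsetSum, Finset.mul_sum]
  refine Finset.sum_congr rfl fun S _ => ?_
  rw [← mul_assoc, ← Finset.prod_mul_distrib]
  congr 1
  refine Finset.prod_congr rfl fun i _ => ?_
  have h : (1 + y i : ℂ) ≠ 0 := by exact_mod_cast (by linarith [hy i] : (1 + y i : ℝ) ≠ 0)
  by_cases hi : i ∈ S <;> simp [hi] <;> field_simp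

/-- If the variables outside `k` are separated, the quotient of two subset sums with the same
coefficients is approximated by the quotient of the contributions of `B` and `insert k B`. -/
theorem exists_subsetSum_div_approx (g : Finset ι → ℂ) (α α' d : ι → ℂ) {B : Finset ι} {k : ι}
    (hk : k ∉ B) {e : ℂ} (hg : g B ≠ 0) (hins : g (insert k B) = g B * e)
    (hα : ∀ i, α i ≠ 0) (hd : ∀ i, d i ≠ 0) {β : ℝ} (hβ : 0 < β)
    (hden : ∀ s t : ℝ, 0 ≤ s → 0 ≤ t → s + t = 1 → β ≤ ‖d k * t + e * α k * s‖) :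
    ∃ C ε₀ : ℝ, 0 ≤ C ∧ 0 < ε₀ ∧ ∀ (ε : ℝ) (y : ι → ℝ), 0 ≤ ε → ε ≤ ε₀ → Separated B k ε y →
      subsetSum g (fun i => α i * y i) d ≠ 0 ∧
      ‖subsetSum g (fun i => α' i * y i) d / subsetSum g (fun i => α i * y i) d -
        (∏ i ∈ B, α' i / α i) * ((d k + e * α' k * y k) / (d k + e * α k * y k))‖ ≤ C * ε := by
  obtain ⟨K, hK0, hK⟩ := exists_subsetSum_approx g α d hk
  obtain ⟨K', hK0', hK'⟩ := exists_subsetSum_approx g α' d hk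
  set m : ℂ := ∏ i ∈ Finset.univ.erase k, B.piecewise α d i with hm
  set m' : ℂ := ∏ i ∈ Finset.univ.erase k, B.piecewise α' d i with hm'
  have hm0 : m ≠ 0 := Finset.prod_ne_zero_iff.2 fun i _ => by
    by_cases hi : i ∈ B <;> simp [hi, hα, hd]
  have hmm : m' / m = ∏ i ∈ B, α' i / α i := by
    rw [hm, hm', ← Finset.prod_div_distrib]
    have hB : B ⊆ Finset.univ.erase k := fun i hi =>
      Finset.mem_erase.2 ⟨fun h => hk (h ▸ hi), Finset.mem_univ i⟩
    rw [← Finset.prod_subset hB]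
    · exact Finset.prod_congr rfl fun i hi => by simp [hi]
    · intro i _ hi
      simp [hi, hd]
  set N : ℕ := (Finset.univ.erase k).card
  -- A lower bound for the dominant part of the denominator: each normalised factor with `i ≠ k` is
  -- at least `1/2` once `ε ≤ 1`, and `β` bounds the factor belonging to `k`.
  set b₀ : ℝ := (1 / 2) ^ N * (‖m‖ * (‖g B‖ * β)) with hb₀def
  have hb₀ : 0 < b₀ := by positivity
  set A : ℝ := ‖m'‖ * (‖g B‖ * (‖d k‖ + ‖e * α' k‖)) with hA
  -- The second threshold keeps the error `K * ε` below half of `b₀`; `K + 1` avoids dividing by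
  -- zero.
  refine ⟨(K' + A / b₀ * K) / (b₀ / 2), min 1 (b₀ / 2 / (K + 1)), by positivity, by positivity,
    fun ε y hε0 hε hy => ?_⟩
  have hε1 : ε ≤ 1 := hε.trans (min_le_left _ _)
  have hKε : K * ε ≤ b₀ / 2 := by
    have h1 := hε.trans (min_le_right _ _)
    rw [le_div_iff₀ (by positivity)] at h1
    nlinarith
  have hy0 : ∀ i, 0 < y i := fun i => (hy i).1
  set s : ι → ℝ := fun i => y i / (1 + y i) with hs
  set t : ι → ℝ := fun i => 1 / (1 + y i) with ht
  have hs0 : ∀ i, 0 ≤ s i := fun i => by have := hy0 i; simp only [hs]; positivity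
  have ht0 : ∀ i, 0 ≤ t i := fun i => by have := hy0 i; simp only [ht]; positivity
  have hst : ∀ i, s i + t i = 1 := fun i => by
    have := hy0 i
    simp only [hs, ht]
    field_simp
    ring
  have hsep : ∀ i, i ≠ k → if i ∈ B then t i ≤ ε else s i ≤ ε := by
    intro i hik
    have h0 := hy0 i
    have h1 := (hy i).2 hik
    split_ifs at h1 ⊢
    · refine le_trans ?_ h1
      rw [← one_div]
      exact one_div_le_one_div_of_le h0 (by linarith)
    · exact (div_le_self h0.le (by linarith)).trans h1
  have hhalf : ∀ i ∈ Finset.univ.erase k, (1 / 2 : ℝ) ≤ B.piecewise s t i := by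
    intro i hi
    have h0 := hy0 i
    have h1 := (hy i).2 (Finset.ne_of_mem_erase hi)
    by_cases hiB : i ∈ B
    · rw [Finset.piecewise_eq_of_mem _ _ _ hiB]
      rw [if_pos hiB] at h1
      have h2 : 1 ≤ y i := by
        have := (inv_le_one₀ h0).1 (h1.trans hε1)
        exact this
      rw [le_div_iff₀ (by linarith)]
      linarith
    · rw [Finset.piecewise_eq_of_notMem _ _ _ hiB]
      rw [if_neg hiB] at h1
      exact one_div_le_one_div_of_le (by linarith) (by linarith)
  have hone : ∀ i ∈ Finset.univ.erase k, B.piecewise s t i ≤ 1 := fun i _ => by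
    by_cases hi : i ∈ B <;> simp [hi] <;> linarith [hs0 i, ht0 i, hst i]
  set π : ℂ := ∏ i ∈ Finset.univ.erase k, B.piecewise (fun i => (s i : ℂ)) (fun i => (t i : ℂ)) i
    with hπ
  have hπnorm : ‖π‖ = ∏ i ∈ Finset.univ.erase k, B.piecewise s t i := by
    rw [hπ, norm_prod]
    refine Finset.prod_congr rfl fun i _ => ?_
    by_cases hi : i ∈ B <;> simp [hi, abs_of_nonneg, hs0, ht0]
  have hπ1 : ‖π‖ ≤ 1 := hπnorm ▸ Finset.prod_le_one
    (fun i hi => le_trans (by norm_num) (hhalf i hi)) hone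
  have hπ2 : (1 / 2 : ℝ) ^ N ≤ ‖π‖ := by
    rw [hπnorm, ← Finset.prod_const]
    exact Finset.prod_le_prod (fun _ _ => by norm_num) hhalf
  have hπ0 : π ≠ 0 := norm_pos_iff.1 (lt_of_lt_of_le (by positivity) hπ2)
  have h1 := hK ε s t hε0 hs0 ht0 hst hsep
  have h2 := hK' ε s t hε0 hs0 ht0 hst hsep
  have hq : ∀ a : ℂ, g B * (d k * t k) + g (insert k B) * (a * s k) =
      g B * (d k * t k + e * a * s k) := fun a => by rw [hins]; ring
  rw [hq] at h1 h2
  have hqk := hden (s k) (t k) (hs0 k) (ht0 k) (hst k)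
  have hb : b₀ ≤ ‖π * (m * (g B * (d k * t k + e * α k * s k)))‖ := by
    rw [norm_mul, norm_mul, norm_mul, hb₀def]
    gcongr
  have ha : ‖π * (m' * (g B * (d k * t k + e * α' k * s k)))‖ ≤ A := by
    rw [norm_mul, norm_mul, norm_mul, hA]
    refine (mul_le_of_le_one_left (by positivity) hπ1).trans ?_
    have hs1 : s k ≤ 1 := by linarith [ht0 k, hst k]
    have ht1 : t k ≤ 1 := by linarith [hs0 k, hst k]
    have : ‖d k * t k + e * α' k * s k‖ ≤ ‖d k‖ + ‖e * α' k‖ := by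
      refine (norm_add_le _ _).trans ?_
      rw [norm_mul (d k), norm_mul (e * α' k), Complex.norm_real, Complex.norm_real,
        Real.norm_of_nonneg (hs0 k), Real.norm_of_nonneg (ht0 k)]
      exact add_le_add (mul_le_of_le_one_right (norm_nonneg _) ht1)
        (mul_le_of_le_one_right (norm_nonneg _) hs1)
    gcongr
  obtain ⟨hne, hle⟩ := norm_div_sub_div_le hb₀ hb ha h2 h1 hKε
  have hX : (∏ i, (1 + y i : ℂ)) ≠ 0 := Finset.prod_ne_zero_iff.2 fun i _ => by
    exact_mod_cast (by linarith [hy0 i] : (1 + y i : ℝ) ≠ 0)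
  rw [subsetSum_normalize g α d hy0, subsetSum_normalize g α' d hy0, mul_div_mul_left _ _ hX]
  refine ⟨mul_ne_zero hX hne, ?_⟩
  have htk : (t k : ℂ) ≠ 0 := by
    have := hy0 k
    exact_mod_cast (by simp only [ht]; positivity : t k ≠ 0)
  have hsk : (s k : ℂ) = y k * t k := by
    rw [← Complex.ofReal_mul]
    congr 1
    simp only [hs, ht]
    ring
  have hlim : π * (m' * (g B * (d k * t k + e * α' k * s k))) /
      (π * (m * (g B * (d k * t k + e * α k * s k)))) =
      (∏ i ∈ B, α' i / α i) * ((d k + e * α' k * y k) / (d k + e * α k * y k)) := by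
    have hf : ∀ a : ℂ, d k * t k + e * a * s k = (d k + e * a * y k) * t k := fun a => by
      rw [hsk]; ring
    rw [mul_div_mul_left _ _ hπ0, mul_div_mul_comm, mul_div_mul_left _ _ hg, hmm, hf, hf,
      mul_div_mul_right _ _ htk]
  rw [hlim] at hle
  refine hle.trans (le_of_eq ?_)
  ring

end DominantMinors

/-! ### Collapse of the superposition to one soliton. -/

section Telescoping

/-- To the left of `k` each `A j` cancels the preceding `S j`; to the right it cancels the following
`S j.succ`. Only `S k` is left unpaired. -/
theorem norm_telescope_sub_le {n : ℕ} {S A : Fin (n + 1) → ℂ} {k : Fin (n + 1)} {δ : ℝ}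
    (h₁ : ∀ j, j < k → ‖S j - A j‖ ≤ δ)
    (h₂ : ∀ j : Fin n, k < j.succ → ‖S j.succ - A j.castSucc‖ ≤ δ) :
    ‖S 0 + ∑ j : Fin n, (S j.succ - A j.castSucc) - S k‖ ≤ n * δ := by
  have hS : S k = S 0 + ∑ j : Fin n, if j.castSucc < k then S j.succ - S j.castSucc else 0 := by
    clear h₁ h₂
    induction k using Fin.induction with
    | zero => simp
    | succ k ih =>
      have : ∀ j : Fin n, (if j.castSucc < k.succ then S j.succ - S j.castSucc else 0) =
          (if j.castSucc < k.castSucc then S j.succ - S j.castSucc else 0) +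
            if j = k then S j.succ - S j.castSucc else 0 := by
        intro j
        rcases lt_trichotomy j k with h | h | h
        · simp [Fin.castSucc_lt_succ_iff, h, h.le, h.ne]
        · simp [Fin.castSucc_lt_succ_iff, h]
        · simp [Fin.castSucc_lt_succ_iff, h.not_ge, h.not_gt, h.ne']
      simp only [this, Finset.sum_add_distrib, Finset.sum_ite_eq', Finset.mem_univ, if_true]
      rw [← add_assoc, ← ih]
      ring
  have hdiff : S 0 + ∑ j : Fin n, (S j.succ - A j.castSucc) - S k =
      ∑ j : Fin n, ((S j.succ - A j.castSucc) -
        if j.castSucc < k then S j.succ - S j.castSucc else 0) := by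
    rw [hS]
    simp only [Finset.sum_sub_distrib]
    ring
  rw [hdiff]
  calc _ ≤ ∑ _j : Fin n, δ := norm_sum_le_of_le _ fun j _ => ?_
    _ = n * δ := by simp
  split_ifs with h
  · simpa using h₁ j.castSucc h
  · rw [sub_zero]
    exact h₂ j (Fin.castSucc_lt_iff_succ_le.not.1 h |> not_le.1)

end Telescoping

/-! ### Estimates for a single soliton. -/

section SingleSoliton

/-- Since `κ` is not real, the denominator of a profile cannot cancel for either sign. Its imaginary
part gives `|Im κ| E`, the reverse triangle inequality gives `‖κ‖ (t - E)`, and twice the first plus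
the second yields the constant `1/3` when `E ≤ t`. -/
theorem abs_im_div_three_mul_add_le {κ : ℂ} {ς : ℝ} (hς : ς = 1 ∨ ς = -1) {E t : ℝ}
    (hE : 0 ≤ E) (ht : 0 ≤ t) :
    |κ.im| / 3 * (t + E) ≤ ‖conj κ * E + (ς : ℂ) * (‖κ‖ : ℂ) * t‖ := by
  have h1 : |κ.im| * E ≤ ‖conj κ * E + (ς : ℂ) * (‖κ‖ : ℂ) * t‖ := by
    refine le_trans (le_of_eq ?_) (Complex.abs_im_le_norm _)
    simp [abs_mul, abs_of_nonneg hE]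
  have h2 : ‖κ‖ * t - ‖κ‖ * E ≤ ‖conj κ * E + (ς : ℂ) * (‖κ‖ : ℂ) * t‖ := by
    have h := norm_sub_le (conj κ * E + (ς : ℂ) * (‖κ‖ : ℂ) * t) (conj κ * E)
    rw [add_sub_cancel_left] at h
    have hn1 : ‖(ς : ℂ) * (‖κ‖ : ℂ) * t‖ = ‖κ‖ * t := by
      rcases hς with rfl | rfl <;> simp [abs_of_nonneg ht]
    have hn2 : ‖conj κ * (E : ℂ)‖ = ‖κ‖ * E := by simp [abs_of_nonneg hE]
    linarith
  have h3 := Complex.abs_im_le_norm κ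
  rcases le_total t E with h | h
  · nlinarith [abs_nonneg κ.im]
  · nlinarith [abs_nonneg κ.im, mul_le_mul_of_nonneg_right h3 (sub_nonneg.2 h)]

/-- A point nearer to `a` than to `b` lies at distance at least `|b - a| / 2` from `b`, on the side
of `a`. The 2 in `exp (2 Re ϑ)` absorbs this half. -/
theorem mul_norm_im_sub_le_of_abs_le {m a b x : ℝ} (h : |x - a| ≤ |x - b|) :
    (0 < m * (b - a) → |m| * |b - a| ≤ 2 * (-m * (x - b))) ∧
      (m * (b - a) < 0 → 2 * (-m * (x - b)) ≤ -(|m| * |b - a|)) := by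
  have key : (b - a) * (b - a) ≤ 2 * ((b - x) * (b - a)) := by
    have := sq_le_sq.2 h
    nlinarith
  constructor <;> intro hm
  · rw [← abs_mul, abs_of_pos hm]
    rcases pos_and_pos_or_neg_and_neg_of_mul_pos hm with ⟨h1, h2⟩ | ⟨h1, h2⟩
    · nlinarith
    · nlinarith
  · rw [← abs_mul, abs_of_neg hm]
    rcases mul_neg_iff.1 hm with ⟨h1, h2⟩ | ⟨h1, h2⟩
    · nlinarith
    · nlinarith

end SingleSoliton

/-! ### The soliton determinants as subset sums. -/

namespace DarkSolitonData

variable {N : ℕ} (p : DarkSolitonData N)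

theorem κ_ne_zero (i : Fin N) : p.κ i ≠ 0 := fun h => p.κ_im_ne i (by simp [h])

theorem conj_κ_ne_zero (i : Fin N) : conj (p.κ i) ≠ 0 := by
  simpa using p.κ_ne_zero i

theorem κ_add_ofReal_ne_zero (i : Fin N) (b : ℝ) : p.κ i + b ≠ 0 := fun h =>
  p.κ_im_ne i (by simpa using congrArg Complex.im h)

theorem theta_re (i : Fin N) (x t : ℝ) :
    (p.theta i x t).re = -(p.κ i).im * (x - p.velocity i * t) := by
  have h : (p.theta i x t) = Complex.I * (p.κ i - p.z i) *
      (x + ((1 / (2 * p.b 0 * p.b 1 * p.z i) : ℝ) : ℂ) *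
        (p.κ i - p.z i + p.b 0 + p.b 1) * t) := by
    rw [theta]
    push_cast
    rfl
  rw [h, velocity]
  simp only [Complex.mul_re, Complex.mul_im, Complex.add_re, Complex.add_im, Complex.sub_re,
    Complex.sub_im, Complex.I_re, Complex.I_im, Complex.ofReal_re, Complex.ofReal_im]
  have h2 : 1 / (2 * p.b 0 * p.b 1 * p.z i) = 1 / (p.b 0 * p.b 1 * p.z i) / 2 := by
    rw [div_div]
    ring
  rw [h2]
  ring

/-- For non-real `κ` the factors `κ + b_s` do not vanish, so the characteristic equation determines
`z` from `κ`. Distinct velocities therefore force distinct `κ_i`. -/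
theorem velocity_eq_of_κ_eq {i j : Fin N} (h : p.κ i = p.κ j) : p.velocity i = p.velocity j := by
  have hi := p.char_eq i
  have hj := p.char_eq j
  rw [← h] at hj
  have h1 : (p.κ i / (spectralZ (p.lam i) : ℂ) - 2) * ((p.κ i + p.b 0) * (p.κ i + p.b 1)) =
      (p.κ i / (spectralZ (p.lam j) : ℂ) - 2) * ((p.κ i + p.b 0) * (p.κ i + p.b 1)) := by
    linear_combination hi - hj
  have h2 := mul_right_cancel₀
    (mul_ne_zero (p.κ_add_ofReal_ne_zero i _) (p.κ_add_ofReal_ne_zero i _)) h1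
  rw [sub_left_inj, div_eq_mul_inv, div_eq_mul_inv] at h2
  have h3 : p.z i = p.z j := by
    exact_mod_cast inv_injective (mul_left_cancel₀ (p.κ_ne_zero i) h2)
  rw [velocity, velocity, h, h3]

/-- The variables `exp (2 Re ϑ_i)`. -/
noncomputable def expTheta (x t : ℝ) (i : Fin N) : ℝ := Real.exp (2 * (p.theta i x t).re)

theorem exp_theta_add_conj (i : Fin N) (x t : ℝ) :
    Complex.exp (p.theta i x t + conj (p.theta i x t)) = p.expTheta x t i := by
  rw [Complex.add_conj, ← Complex.ofReal_exp]
  rfl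

/-- Principal minors of the Cauchy matrix `1 / (κ_j - κ_i^*)`. -/
noncomputable def minor (S : Finset (Fin N)) : ℂ := principalMinor (cauchyMatrix p.κ fun i => conj (p.κ i)) S

/-- Diagonal part of the soliton matrices. -/
noncomputable def diagPart (i : Fin N) : ℂ := (p.sgn i : ℂ) * (‖p.κ i‖ : ℂ) / (p.κ i - conj (p.κ i))

/-- `|(κ_k - κ_i) / (κ_k^* - κ_i)|²` multiplied over `i ∈ B`. -/
noncomputable def interaction (B : Finset (Fin N)) (k : Fin N) : ℝ :=
  ∏ i ∈ B, ‖(p.κ k - p.κ i) / (conj (p.κ k) - p.κ i)‖ ^ 2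

/-- The phase of the `k`-th soliton shifted by its interaction with the solitons in `B`. -/
noncomputable def shiftedTheta (B : Finset (Fin N)) (k : Fin N) (x t : ℝ) : ℂ :=
  p.theta k x t + ∑ i ∈ B, (Real.log ‖(p.κ k - p.κ i) / (conj (p.κ k) - p.κ i)‖ : ℂ)

/-- Product of the phase factors `(κ_i^* + b_s) κ_i / ((κ_i + b_s) κ_i^*)` over `i ∈ B`. -/
noncomputable def phaseProd (s : Fin 2) (B : Finset (Fin N)) : ℂ :=
  ∏ i ∈ B, ((conj (p.κ i) + p.b s) * p.κ i) / ((p.κ i + p.b s) * conj (p.κ i))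

theorem det_M (x t : ℝ) : (p.M x t).det = (∏ j, 2 * (p.lam j)⁻¹) *
    subsetSum p.minor (fun i => conj (p.κ i) * p.expTheta x t i) p.diagPart := by
  simp only [subsetSum, minor]
  rw [← det_row_mul_add_diagonal, ← Matrix.det_mul_row]
  congr 1
  ext i j
  rw [M]
  simp only [Matrix.of_apply, exp_theta_add_conj, cauchyMatrix, diagPart]
  by_cases h : i = j
  · subst h
    simp only [if_true]
    ring
  · simp only [h, if_false]
    ring

theorem det_H (s : Fin 2) (x t : ℝ) : (p.H s x t).det = (∏ j, 2 * (p.lam j)⁻¹) *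
    subsetSum p.minor (fun i => p.expTau s i * p.κ i * p.expTheta x t i) p.diagPart := by
  -- The entries of `H_s` split into a row factor and a column factor; on a principal minor both run
  -- over the same indices and recombine to `e^{iτ_i} κ_i`.
  have hw : (fun i => p.expTau s i * p.κ i * (p.expTheta x t i : ℂ)) =
      fun i => ((conj (p.κ i) + p.b s) * p.expTheta x t i) * (p.κ i / (p.κ i + p.b s)) := by
    ext i
    rw [expTau]
    ring
  simp only [subsetSum, minor]
  rw [hw, ← det_row_col_mul_add_diagonal, ← Matrix.det_mul_row]
  congr 1
  ext i j
  rw [H]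
  simp only [Matrix.of_apply, exp_theta_add_conj, cauchyMatrix, diagPart]
  by_cases h : i = j
  · subst h
    simp only [if_true]
    ring
  · simp only [h, if_false]
    ring

/-! ### Asymptotics near and far from one soliton. -/

section Distinct

variable {p} (hd : ∀ i j, p.κ j - conj (p.κ i) ≠ 0) (hinj : Function.Injective p.κ)
include hd

theorem minor_insert {B : Finset (Fin N)} {k : Fin N} (hk : k ∉ B) :
    p.minor (insert k B) =
      p.minor B * (1 / (p.κ k - conj (p.κ k)) * (p.interaction B k : ℂ)) := by
  rw [minor, principalMinor_cauchyMatrix_insert hd hk, minor, interaction, Complex.ofReal_prod]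
  congr 2
  refine Finset.prod_congr rfl fun i _ => ?_
  rw [Complex.ofReal_pow, ← Complex.mul_conj', map_div₀, map_sub, map_sub, Complex.conj_conj,
    div_mul_div_comm, ← neg_sub (p.κ k) (p.κ i), ← neg_sub (conj (p.κ k)) (p.κ i), neg_mul,
    neg_mul, neg_div_neg_eq]

include hinj

theorem minor_ne_zero (S : Finset (Fin N)) : p.minor S ≠ 0 :=
  principalMinor_cauchyMatrix_ne_zero hd hinj ((starRingEnd ℂ).injective.comp hinj) S

theorem norm_quotient_pos {i k : Fin N} (h : i ≠ k) :
    0 < ‖(p.κ k - p.κ i) / (conj (p.κ k) - p.κ i)‖ := by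
  refine norm_pos_iff.2 (div_ne_zero (sub_ne_zero.2 (hinj.ne h.symm)) fun h0 => hd k i ?_)
  rw [← neg_sub, h0, neg_zero]

theorem interaction_pos {B : Finset (Fin N)} {k : Fin N} (hk : k ∉ B) :
    0 < p.interaction B k :=
  Finset.prod_pos fun _ hi => pow_pos (norm_quotient_pos hd hinj (ne_of_mem_of_not_mem hi hk)) 2

theorem exp_shiftedTheta {B : Finset (Fin N)} {k : Fin N} (hk : k ∉ B) (x t : ℝ) :
    Real.exp (2 * (p.shiftedTheta B k x t).re) = p.interaction B k * p.expTheta x t k := by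
  have h : (p.shiftedTheta B k x t).re = (p.theta k x t).re +
      ∑ i ∈ B, Real.log ‖(p.κ k - p.κ i) / (conj (p.κ k) - p.κ i)‖ := by
    rw [shiftedTheta, ← Complex.ofReal_sum, Complex.add_re, Complex.ofReal_re]
  rw [h, mul_add, Real.exp_add, mul_comm, Finset.mul_sum, Real.exp_sum, expTheta, interaction]
  congr 1
  refine Finset.prod_congr rfl fun i hi => ?_
  rw [two_mul, Real.exp_add, Real.exp_log (norm_quotient_pos hd hinj (ne_of_mem_of_not_mem hi hk)), sq]

/-- Near the `k`-th soliton, with the solitons in `B` on the far side, `det H / det M` is close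
to the profile of the `k`-th soliton. -/
theorem exists_det_div_approx (s : Fin 2) {B : Finset (Fin N)} {k : Fin N} (hk : k ∉ B) :
    ∃ C ε₀ : ℝ, 0 ≤ C ∧ 0 < ε₀ ∧ ∀ ε x t : ℝ, 0 ≤ ε → ε ≤ ε₀ →
      Separated B k ε (p.expTheta x t) → (p.M x t).det ≠ 0 ∧
      ‖(p.H s x t).det / (p.M x t).det -
        p.phaseProd s B * p.profile s k (p.shiftedTheta B k x t)‖ ≤ C * ε := by
  have hγ : ∀ i, p.κ i - conj (p.κ i) ≠ 0 := fun i => hd i i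
  have hρ : 0 < p.interaction B k := interaction_pos hd hinj hk
  have hdiag : ∀ i, p.diagPart i ≠ 0 := fun i => by
    refine div_ne_zero (mul_ne_zero ?_ ?_) (hγ i)
    · rcases p.sgn_eq i with h | h <;> simp [h]
    · simpa using p.κ_ne_zero i
  have hq : ∀ (a : ℂ) (u v : ℝ), p.diagPart k * u +
      1 / (p.κ k - conj (p.κ k)) * (p.interaction B k : ℂ) * a * v =
      1 / (p.κ k - conj (p.κ k)) * (a * ((p.interaction B k * v : ℝ) : ℂ) +
        (p.sgn k : ℂ) * (‖p.κ k‖ : ℂ) * u) := fun a u v => by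
    rw [diagPart]
    push_cast
    ring
  set β : ℝ := ‖1 / (p.κ k - conj (p.κ k))‖ *
    (|(p.κ k).im| / 3 * min (p.interaction B k) 1) with hβdef
  have hβ : 0 < β := by
    have h1 : 0 < ‖1 / (p.κ k - conj (p.κ k))‖ := norm_pos_iff.2 (one_div_ne_zero (hγ k))
    have h2 : 0 < |(p.κ k).im| := abs_pos.2 (p.κ_im_ne k)
    have h3 : 0 < min (p.interaction B k) 1 := lt_min hρ one_pos
    positivity
  obtain ⟨C, ε₀, hC, hε₀, h⟩ := exists_subsetSum_div_approx p.minor (fun i => conj (p.κ i))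
    (fun i => p.expTau s i * p.κ i) p.diagPart hk (minor_ne_zero hd hinj B) (minor_insert hd hk)
    p.conj_κ_ne_zero hdiag hβ (fun u v hu hv huv => by
      rw [hq, norm_mul, hβdef]
      refine mul_le_mul_of_nonneg_left (le_trans ?_ (abs_im_div_three_mul_add_le (p.sgn_eq k)
        (mul_nonneg hρ.le hu) hv)) (norm_nonneg _)
      refine mul_le_mul_of_nonneg_left ?_ (by positivity)
      calc min (p.interaction B k) 1
          = min (p.interaction B k) 1 * v + min (p.interaction B k) 1 * u := by
            rw [← mul_add, add_comm v, huv, mul_one]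
        _ ≤ 1 * v + p.interaction B k * u := by gcongr <;> simp
        _ = v + p.interaction B k * u := by rw [one_mul])
  refine ⟨C, ε₀, hC, hε₀, fun ε x t hε0 hε hsep => ?_⟩
  obtain ⟨h1, h2⟩ := h ε _ hε0 hε hsep
  have hL : (∏ j, 2 * (p.lam j)⁻¹) ≠ 0 := Finset.prod_ne_zero_iff.2 fun j _ =>
    mul_ne_zero two_ne_zero (inv_ne_zero (p.lam_ne j))
  rw [det_M, det_H, mul_div_mul_left _ _ hL]
  refine ⟨mul_ne_zero hL h1, ?_⟩
  convert h2 using 4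
  · refine Finset.prod_congr rfl fun i _ => ?_
    rw [expTau]
    field_simp
  · have h3 := hq (conj (p.κ k)) 1 (p.expTheta x t k)
    have h4 := hq (p.expTau s k * p.κ k) 1 (p.expTheta x t k)
    rw [Complex.ofReal_one, mul_one, mul_one] at h3 h4
    rw [h3, h4, mul_div_mul_left _ _ (one_div_ne_zero (hγ k)), profile,
      exp_shiftedTheta hd hinj hk]
    congr 2
    ring

/-- Far from its centre a soliton is close to one of its two limits. -/
theorem exists_profile_approx (s : Fin 2) {B : Finset (Fin N)} {k : Fin N} (hk : k ∉ B) :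
    ∃ C : ℝ, 0 ≤ C ∧ ∀ ε x t : ℝ,
      (p.expTheta x t k ≤ ε → ‖p.profile s k (p.shiftedTheta B k x t) - 1‖ ≤ C * ε) ∧
      ((p.expTheta x t k)⁻¹ ≤ ε → ‖p.profile s k (p.shiftedTheta B k x t) -
        p.expTau s k * (p.κ k / conj (p.κ k))‖ ≤ C * ε) := by
  have hρ : 0 < p.interaction B k := interaction_pos hd hinj hk
  have hβ : 0 < |(p.κ k).im| / 3 := div_pos (abs_pos.2 (p.κ_im_ne k)) three_pos
  set ρ := p.interaction B k
  set β := |(p.κ k).im| / 3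
  set C₁ : ℝ := ‖p.κ k * p.expTau s k - conj (p.κ k)‖ * ρ / β with hC₁
  set C₂ : ℝ :=
    ‖(p.sgn k : ℂ) * (‖p.κ k‖ : ℂ) * (1 - p.expTau s k * (p.κ k / conj (p.κ k)))‖ / (β * ρ)
    with hC₂
  have hC₁0 : 0 ≤ C₁ := by positivity
  have hC₂0 : 0 ≤ C₂ := by positivity
  refine ⟨C₁ + C₂, by positivity, fun ε x t => ?_⟩
  have hy : 0 < p.expTheta x t k := Real.exp_pos _
  set y := p.expTheta x t k
  have hD := abs_im_div_three_mul_add_le (κ := p.κ k) (p.sgn_eq k) (mul_pos hρ hy).le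
    (zero_le_one (α := ℝ))
  rw [Complex.ofReal_one, mul_one] at hD
  change β * (1 + ρ * y) ≤ _ at hD
  set D : ℂ := conj (p.κ k) * ((ρ * y : ℝ) : ℂ) + (p.sgn k : ℂ) * (‖p.κ k‖ : ℂ) with hDdef
  have hDpos : 0 < ‖D‖ := lt_of_lt_of_le (by positivity) hD
  have hD0 : D ≠ 0 := norm_pos_iff.1 hDpos
  have hprof : p.profile s k (p.shiftedTheta B k x t) =
      (p.κ k * (((ρ * y : ℝ) : ℂ) * p.expTau s k) + (p.sgn k : ℂ) * (‖p.κ k‖ : ℂ)) / D := by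
    rw [profile, exp_shiftedTheta hd hinj hk]
  have hκ := p.conj_κ_ne_zero k
  constructor
  · intro h
    have he : p.profile s k (p.shiftedTheta B k x t) - 1 =
        (p.κ k * p.expTau s k - conj (p.κ k)) * ((ρ * y : ℝ) : ℂ) / D := by
      rw [hprof, div_sub_one hD0, hDdef]
      congr 1
      ring
    have hDβ : β ≤ ‖D‖ := le_trans (by nlinarith [mul_pos hβ (mul_pos hρ hy)]) hD
    rw [he, norm_div, norm_mul, Complex.norm_real, Real.norm_of_nonneg (mul_pos hρ hy).le]
    calc _ ≤ ‖p.κ k * p.expTau s k - conj (p.κ k)‖ * (ρ * y) / β := by gcongr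
      _ = C₁ * y := by rw [hC₁]; ring
      _ ≤ (C₁ + C₂) * ε := mul_le_mul (by linarith) h hy.le (by positivity)
  · intro h
    have he : p.profile s k (p.shiftedTheta B k x t) - p.expTau s k * (p.κ k / conj (p.κ k)) =
        (p.sgn k : ℂ) * (‖p.κ k‖ : ℂ) * (1 - p.expTau s k * (p.κ k / conj (p.κ k))) / D := by
      rw [hprof, div_sub' hD0, hDdef]
      congr 1
      field_simp
      ring
    have hDβ : β * ρ * y ≤ ‖D‖ := le_trans (by nlinarith [mul_pos hβ (mul_pos hρ hy)]) hD
    rw [he, norm_div]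
    calc _ ≤ ‖(p.sgn k : ℂ) * (‖p.κ k‖ : ℂ) *
          (1 - p.expTau s k * (p.κ k / conj (p.κ k)))‖ / (β * ρ * y) := by gcongr
      _ = C₂ * y⁻¹ := by rw [hC₂, ← div_div, div_eq_mul_inv _ y]
      _ ≤ (C₁ + C₂) * ε := mul_le_mul (by linarith) h (inv_pos.2 hy).le (by positivity)

end Distinct

end DarkSolitonData

/-! ### Cauchy determinants, ordering of the solitons and their superposition. -/

namespace DarkSolitonData

section Ordering

variable {N : ℕ} (p : DarkSolitonData N)

theorem cauchyDet_eq_minor (m : ℕ) (hm : m ≤ N) :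
    p.cauchyDet m hm = p.minor (Finset.univ.map (Fin.castLEEmb hm)) := by
  let e : Fin m ≃ ↥(Finset.univ.map (Fin.castLEEmb hm)) :=
    Equiv.ofBijective (fun i => ⟨Fin.castLE hm i, by simp⟩)
      ⟨fun i j h => by simpa using h, fun ⟨i, hi⟩ => by
        obtain ⟨j, -, rfl⟩ := Finset.mem_map.1 hi
        exact ⟨j, rfl⟩⟩
  rw [minor, principalMinor, ← Matrix.det_submatrix_equiv_self e]
  rfl

theorem map_castLEEmb_val (k : Fin N) :
    Finset.univ.map (Fin.castLEEmb k.is_lt.le) = Finset.Iio k := by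
  ext i
  simp only [Finset.mem_map, Finset.mem_univ, true_and, Finset.mem_Iio]
  constructor
  · rintro ⟨j, rfl⟩
    exact j.is_lt
  · intro h
    exact ⟨⟨i, h⟩, rfl⟩

theorem map_castLEEmb_val_add_one (k : Fin N) :
    Finset.univ.map (Fin.castLEEmb (Nat.succ_le_of_lt k.is_lt)) =
      insert k (Finset.Iio k) := by
  ext i
  rw [Finset.Iio_insert]
  simp only [Finset.mem_map, Finset.mem_univ, true_and, Finset.mem_Iic]
  constructor
  · rintro ⟨j, rfl⟩
    exact Nat.lt_succ_iff.1 j.is_lt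
  · intro h
    exact ⟨⟨i, Nat.lt_succ_iff.2 h⟩, rfl⟩

theorem exists_separated [NeZero N]
    (hgt : ∀ i k, k < i → 0 < (p.κ i).im * (p.velocity i - p.velocity k))
    (hlt : ∀ i k, i < k → (p.κ i).im * (p.velocity i - p.velocity k) < 0)
    {ε t : ℝ} (hε : ∀ i k, i ≠ k →
      Real.exp (-(|(p.κ i).im| * |p.velocity i - p.velocity k| * |t|)) ≤ ε) (x : ℝ) :
    ∃ k, (t < 0 → Separated (Finset.Iio k) k ε (p.expTheta x t)) ∧
      (0 < t → Separated (Finset.Ioi k) k ε (p.expTheta x t)) := by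
  -- The nearest soliton serves as `k`, so every `x` is covered without dividing the line into
  -- regions.
  obtain ⟨k, hk⟩ := Finite.exists_min fun i => |x - p.velocity i * t|
  have hkey : ∀ i, i ≠ k →
      (0 < (p.κ i).im * (p.velocity i - p.velocity k) * t → (p.expTheta x t i)⁻¹ ≤ ε) ∧
      ((p.κ i).im * (p.velocity i - p.velocity k) * t < 0 → p.expTheta x t i ≤ ε) := by
    intro i hik
    have h1 := mul_norm_im_sub_le_of_abs_le (m := (p.κ i).im) (hk i)
    rw [← sub_mul, ← mul_assoc, abs_mul, ← mul_assoc] at h1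
    rw [expTheta, theta_re, ← Real.exp_neg]
    exact ⟨fun h => (Real.exp_le_exp.2 (neg_le_neg (h1.1 h))).trans (hε i k hik),
      fun h => (Real.exp_le_exp.2 (h1.2 h)).trans (hε i k hik)⟩
  refine ⟨k, fun ht i => ⟨Real.exp_pos _, fun hik => ?_⟩,
    fun ht i => ⟨Real.exp_pos _, fun hik => ?_⟩⟩
  · rcases hik.lt_or_gt with h | h
    · rw [if_pos (Finset.mem_Iio.2 h)]
      exact (hkey i hik).1 (mul_pos_of_neg_of_neg (hlt i k h) ht)
    · rw [if_neg (by simpa using h.le)]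
      exact (hkey i hik).2 (mul_neg_of_pos_of_neg (hgt i k h) ht)
  · rcases hik.lt_or_gt with h | h
    · rw [if_neg (by simpa using h.le)]
      exact (hkey i hik).2 (mul_neg_of_neg_of_pos (hlt i k h) ht)
    · rw [if_pos (Finset.mem_Ioi.2 h)]
      exact (hkey i hik).1 (mul_pos (hgt i k h) ht)

end Ordering

variable {n : ℕ} {p : DarkSolitonData (n + 1)}

/-- Superposition of solitons, for any family `B k` of indices of the solitons which are large
near the centre of the `k`-th one and matching asymptotic values `A`. -/
theorem exists_u_approx (hd : ∀ i j, p.κ j - conj (p.κ i) ≠ 0) (hinj : Function.Injective p.κ)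
    (s : Fin 2) (B : Fin (n + 1) → Finset (Fin (n + 1))) (hB : ∀ k, k ∉ B k)
    (A : Fin (n + 1) → ℂ)
    (hA₁ : ∀ j k, j < k → A j = p.phaseProd s (B j) *
      if j ∈ B k then p.expTau s j * (p.κ j / conj (p.κ j)) else 1)
    (hA₂ : ∀ (j : Fin n) k, k < j.succ → A j.castSucc = p.phaseProd s (B j.succ) *
      if j.succ ∈ B k then p.expTau s j.succ * (p.κ j.succ / conj (p.κ j.succ)) else 1) :
    ∃ C ε₀ : ℝ, 0 ≤ C ∧ 0 < ε₀ ∧ ∀ (ε x t : ℝ) (k : Fin (n + 1)), 0 ≤ ε → ε ≤ ε₀ →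
      Separated (B k) k ε (p.expTheta x t) → (p.M x t).det ≠ 0 ∧
      ‖p.u s x t - p.a s *
        (p.phaseProd s (B 0) * p.profile s 0 (p.shiftedTheta (B 0) 0 x t) +
          ∑ j : Fin n, (p.phaseProd s (B j.succ) *
            p.profile s j.succ (p.shiftedTheta (B j.succ) j.succ x t) - A j.castSucc)) *
        Complex.exp (Complex.I * p.omega s x t)‖ ≤ C * ε := by
  choose C₁ ε₁ hC₁ hε₁ h₁ using fun k => exists_det_div_approx hd hinj s (hB k)
  choose C₂ hC₂ h₂ using fun k => exists_profile_approx hd hinj s (hB k)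
  set K : ℝ := ∑ j, ‖p.phaseProd s (B j)‖ * C₂ j with hK
  have hK0 : 0 ≤ K := Finset.sum_nonneg fun j _ => mul_nonneg (norm_nonneg _) (hC₂ j)
  have hC0 : 0 ≤ ∑ j, C₁ j := Finset.sum_nonneg fun j _ => hC₁ j
  refine ⟨|p.a s| * (∑ j, C₁ j + n * K), Finset.univ.inf' Finset.univ_nonempty ε₁,
    by positivity, (Finset.lt_inf'_iff _).2 fun k _ => hε₁ k, fun ε x t k hε0 hε hsep => ?_⟩
  obtain ⟨hM, hu⟩ := h₁ k ε x t hε0 (hε.trans (Finset.inf'_le _ (Finset.mem_univ k))) hsep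
  refine ⟨hM, ?_⟩
  set S : Fin (n + 1) → ℂ := fun j =>
    p.phaseProd s (B j) * p.profile s j (p.shiftedTheta (B j) j x t) with hS
  have hlim : ∀ j, j ≠ k → ‖S j - p.phaseProd s (B j) *
      if j ∈ B k then p.expTau s j * (p.κ j / conj (p.κ j)) else 1‖ ≤ K * ε := by
    intro j hjk
    have hj := (hsep j).2 hjk
    have hprof : ‖p.profile s j (p.shiftedTheta (B j) j x t) -
        if j ∈ B k then p.expTau s j * (p.κ j / conj (p.κ j)) else 1‖ ≤ C₂ j * ε := by
      split_ifs at hj ⊢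
      · exact (h₂ j ε x t).2 hj
      · exact (h₂ j ε x t).1 hj
    rw [hS, ← mul_sub, norm_mul]
    refine (mul_le_mul_of_nonneg_left hprof (norm_nonneg _)).trans ?_
    rw [← mul_assoc]
    refine mul_le_mul_of_nonneg_right ?_ hε0
    exact Finset.single_le_sum (f := fun j => ‖p.phaseProd s (B j)‖ * C₂ j)
      (fun j _ => mul_nonneg (norm_nonneg _) (hC₂ j)) (Finset.mem_univ j)
  -- `hA₁` and `hA₂` say that `A j` is the limit of `S j` when `j < k`, and of `S j.succ` when `k <
  -- j.succ`.
  have htel := norm_telescope_sub_le (S := S) (A := A) (k := k) (δ := K * ε)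
    (fun j hj => by rw [hA₁ j k hj]; exact hlim j hj.ne)
    (fun j hj => by rw [hA₂ j k hj]; exact hlim j.succ hj.ne')
  have hC₁k : C₁ k * ε ≤ (∑ j, C₁ j) * ε := mul_le_mul_of_nonneg_right
    (Finset.single_le_sum (fun j _ => hC₁ j) (Finset.mem_univ k)) hε0
  have hfac : p.u s x t - p.a s * (S 0 + ∑ j : Fin n, (S j.succ - A j.castSucc)) *
      Complex.exp (Complex.I * p.omega s x t) =
      p.a s * (((p.H s x t).det / (p.M x t).det - S k) -
        (S 0 + ∑ j : Fin n, (S j.succ - A j.castSucc) - S k)) *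
      Complex.exp (Complex.I * p.omega s x t) := by
    rw [u]
    ring
  change ‖p.u s x t - p.a s * (S 0 + ∑ j : Fin n, (S j.succ - A j.castSucc)) *
      Complex.exp (Complex.I * p.omega s x t)‖ ≤ _
  rw [hfac, norm_mul, norm_mul, Complex.norm_exp_I_mul_ofReal, mul_one, Complex.norm_real,
    Real.norm_eq_abs, mul_assoc]
  refine mul_le_mul_of_nonneg_left ?_ (abs_nonneg _)
  refine (norm_sub_le _ _).trans ((add_le_add (hu.trans hC₁k) htel).trans (le_of_eq ?_))
  ring

variable (p) in
theorem phaseProd_insert (s : Fin 2) {B : Finset (Fin (n + 1))} {k : Fin (n + 1)} (hk : k ∉ B) :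
    p.phaseProd s (insert k B) =
      p.phaseProd s B * (p.expTau s k * (p.κ k / conj (p.κ k))) := by
  rw [phaseProd, Finset.prod_insert hk, phaseProd, expTau, div_mul_div_comm, mul_comm]

theorem exists_approxMinus (hd : ∀ i j, p.κ j - conj (p.κ i) ≠ 0)
    (hinj : Function.Injective p.κ) (s : Fin 2) :
    ∃ C ε₀ : ℝ, 0 ≤ C ∧ 0 < ε₀ ∧ ∀ (ε x t : ℝ) (k : Fin (n + 1)), 0 ≤ ε → ε ≤ ε₀ →
      Separated (Finset.Iio k) k ε (p.expTheta x t) → (p.M x t).det ≠ 0 ∧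
      ‖p.u s x t - p.approxMinus s x t‖ ≤ C * ε := by
  refine exists_u_approx hd hinj s Finset.Iio (fun k => by simp) (p.AMinus s) ?_ ?_
  · intro j k hjk
    rw [if_pos (Finset.mem_Iio.2 hjk), ← mul_assoc]
    rfl
  · intro j k hkj
    rw [if_neg (by simpa using hkj.le), mul_one]
    have h : Finset.Iio j.succ = insert j.castSucc (Finset.Iio j.castSucc) := by
      ext i
      rw [Finset.Iio_insert, Finset.mem_Iio, Finset.mem_Iic, Fin.le_castSucc_iff]
    rw [h, p.phaseProd_insert s (by simp), ← mul_assoc]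
    rfl

theorem exists_approxPlus (hd : ∀ i j, p.κ j - conj (p.κ i) ≠ 0)
    (hinj : Function.Injective p.κ) (s : Fin 2) :
    ∃ C ε₀ : ℝ, 0 ≤ C ∧ 0 < ε₀ ∧ ∀ (ε x t : ℝ) (k : Fin (n + 1)), 0 ≤ ε → ε ≤ ε₀ →
      Separated (Finset.Ioi k) k ε (p.expTheta x t) → (p.M x t).det ≠ 0 ∧
      ‖p.u s x t - p.approxPlus s x t‖ ≤ C * ε := by
  refine exists_u_approx hd hinj s Finset.Ioi (fun k => by simp) (p.APlus s) ?_ ?_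
  · intro j k hjk
    rw [if_neg (by simpa using hjk.le), mul_one]
    rfl
  · intro j k hkj
    rw [if_pos (Finset.mem_Ioi.2 hkj)]
    have h : Finset.Ioi j.castSucc = insert j.succ (Finset.Ioi j.succ) := by
      ext i
      rw [Finset.Ioi_insert, Finset.mem_Ioi, Finset.mem_Ici, Fin.castSucc_lt_iff_succ_le]
    rw [← p.phaseProd_insert s (by simp), ← h]
    rfl

theorem decayRate_le (i j : Fin (n + 1)) (hij : i ≠ j) :
    p.decayRate ≤ |(p.κ i).im| * |p.velocity i - p.velocity j| := by
  refine mul_le_mul (ciInf_le (Set.finite_range _).bddBelow i) ?_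
    (Real.iInf_nonneg fun _ => abs_nonneg _) (abs_nonneg _)
  exact ciInf_le (f := fun q : {q : Fin (n + 1) × Fin (n + 1) // q.1 ≠ q.2} =>
    |p.velocity q.1.1 - p.velocity q.1.2|) (Set.finite_range _).bddBelow ⟨(i, j), hij⟩

/-- For `n = 0` the infimum over pairs is empty and takes the default value `0`; hence the
restriction on `n`. -/
theorem decayRate_pos (hn : 1 ≤ n) (hv : Function.Injective p.velocity) : 0 < p.decayRate := by
  have hne : (0 : Fin (n + 1)) ≠ Fin.last n := by
    rw [Ne, Fin.ext_iff]
    simp only [Fin.val_zero, Fin.val_last]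
    omega
  have : Nonempty {q : Fin (n + 1) × Fin (n + 1) // q.1 ≠ q.2} := ⟨⟨(0, Fin.last n), hne⟩⟩
  obtain ⟨i, hi⟩ := exists_eq_ciInf_of_finite (f := fun i => |(p.κ i).im|)
  obtain ⟨q, hq⟩ := exists_eq_ciInf_of_finite
    (f := fun q : {q : Fin (n + 1) × Fin (n + 1) // q.1 ≠ q.2} =>
      |p.velocity q.1.1 - p.velocity q.1.2|)
  rw [decayRate, ← hi, ← hq]
  exact mul_pos (abs_pos.2 (p.κ_im_ne i)) (abs_pos.2 (sub_ne_zero.2 (hv.ne q.2)))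

end DarkSolitonData

/-! ### The asymptotic theorem. -/

theorem proposition5 {n : ℕ} (p : DarkSolitonData (n + 1))
    (hord : ((∀ k, 0 < (p.κ k).im) ∧ StrictMono p.velocity) ∨
      ((∀ k, (p.κ k).im < 0) ∧ StrictAnti p.velocity))
    (c : ℝ) (hc : 1 ≤ n → c = p.decayRate) :
    (1 ≤ n → 0 < c) ∧
    (∃ C T : ℝ, 0 < T ∧ ∀ (s : Fin 2) (x t : ℝ),
      (t ≤ -T → (p.M x t).det ≠ 0 ∧
        ‖p.u s x t - p.approxMinus s x t‖ ≤ C * Real.exp (-c * |t|)) ∧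
      (T ≤ t → (p.M x t).det ≠ 0 ∧
        ‖p.u s x t - p.approxPlus s x t‖ ≤ C * Real.exp (-c * |t|))) ∧
    (∀ k : Fin (n + 1),
      p.cauchyDet k k.is_lt.le ≠ 0 ∧
      p.cauchyDet (k + 1) k.is_lt / p.cauchyDet k k.is_lt.le =
        1 / (p.κ k - conj (p.κ k)) *
          ∏ i ∈ Finset.Iio k, (‖(p.κ k - p.κ i) / (conj (p.κ k) - p.κ i)‖ : ℂ) ^ 2) := by
  have hv : Function.Injective p.velocity := by
    rcases hord with h | h
    exacts [h.2.injective, h.2.injective]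
  have hinj : Function.Injective p.κ := fun i j h => hv (p.velocity_eq_of_κ_eq h)
  have hd : ∀ i j, p.κ j - conj (p.κ i) ≠ 0 := by
    intro i j h
    have h' : (p.κ j).im + (p.κ i).im = 0 := by simpa using congrArg Complex.im h
    rcases hord with ⟨h1, -⟩ | ⟨h1, -⟩
    · linarith [h1 i, h1 j]
    · linarith [h1 i, h1 j]
  have hgt : ∀ i k, k < i → 0 < (p.κ i).im * (p.velocity i - p.velocity k) := fun i k h => by
    rcases hord with ⟨h1, h2⟩ | ⟨h1, h2⟩
    · exact mul_pos (h1 i) (sub_pos.2 (h2 h))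
    · exact mul_pos_of_neg_of_neg (h1 i) (sub_neg.2 (h2 h))
  have hlt : ∀ i k, i < k → (p.κ i).im * (p.velocity i - p.velocity k) < 0 := fun i k h => by
    rcases hord with ⟨h1, h2⟩ | ⟨h1, h2⟩
    · exact mul_neg_of_pos_of_neg (h1 i) (sub_neg.2 (h2 h))
    · exact mul_neg_of_neg_of_pos (h1 i) (sub_pos.2 (h2 h))
  have hcpos : 1 ≤ n → 0 < c := fun hn => hc hn ▸ DarkSolitonData.decayRate_pos hn hv
  refine ⟨hcpos, ?_, fun k => ?_⟩
  · choose C₁ ε₁ hC₁ hε₁ h₁ using DarkSolitonData.exists_approxMinus hd hinj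
    choose C₂ ε₂ hC₂ hε₂ h₂ using DarkSolitonData.exists_approxPlus hd hinj
    obtain ⟨ε₀, hε₀, hle⟩ : ∃ ε₀ : ℝ, 0 < ε₀ ∧ ∀ s, ε₀ ≤ ε₁ s ∧ ε₀ ≤ ε₂ s := by
      refine ⟨Finset.univ.inf' Finset.univ_nonempty fun s => min (ε₁ s) (ε₂ s),
        (Finset.lt_inf'_iff _).2 fun s _ => lt_min (hε₁ s) (hε₂ s), fun s => ?_⟩
      exact le_min_iff.1 (Finset.inf'_le (fun s => min (ε₁ s) (ε₂ s)) (Finset.mem_univ s))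
    have hCle : ∀ s, C₁ s ≤ ∑ s, (C₁ s + C₂ s) ∧ C₂ s ≤ ∑ s, (C₁ s + C₂ s) := fun s => by
      have := Finset.single_le_sum (f := fun s => C₁ s + C₂ s)
        (fun s _ => add_nonneg (hC₁ s) (hC₂ s)) (Finset.mem_univ s)
      exact ⟨by linarith [hC₂ s], by linarith [hC₁ s]⟩
    -- When `n ≥ 1`, the second entry of the maximum ensures `exp (-c |t|) ≤ ε₀`; the first makes
    -- the threshold positive.
    refine ⟨∑ s, (C₁ s + C₂ s), max 1 (-Real.log ε₀ / c), by positivity, fun s x t => ?_⟩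
    have hmain : max 1 (-Real.log ε₀ / c) ≤ |t| → ∃ ε k, 0 ≤ ε ∧ ε ≤ ε₀ ∧
        ε ≤ Real.exp (-c * |t|) ∧ (t < 0 → Separated (Finset.Iio k) k ε (p.expTheta x t)) ∧
        (0 < t → Separated (Finset.Ioi k) k ε (p.expTheta x t)) := by
      intro ht
      -- With a single soliton there is nothing to separate, so `ε = 0` is admissible: the
      -- approximation is exact and any real `c` works.
      rcases Nat.eq_zero_or_pos n with rfl | hn
      · obtain ⟨k, hk⟩ := p.exists_separated hgt hlt (ε := 0) (t := t)
          (fun i k hik => (hik (Fin.ext (by omega))).elim) x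
        exact ⟨0, k, le_rfl, hε₀.le, (Real.exp_pos _).le, hk⟩
      · obtain ⟨k, hk⟩ := p.exists_separated hgt hlt (ε := Real.exp (-c * |t|)) (t := t)
          (fun i k hik => by
            rw [Real.exp_le_exp, neg_mul, neg_le_neg_iff, hc hn]
            exact mul_le_mul_of_nonneg_right (DarkSolitonData.decayRate_le i k hik)
              (abs_nonneg t)) x
        refine ⟨_, k, (Real.exp_pos _).le, ?_, le_rfl, hk⟩
        have h1 := (div_le_iff₀ (hcpos hn)).1 ((le_max_right _ _).trans ht)
        rw [← Real.le_log_iff_exp_le hε₀]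
        linarith
    have hT : 0 < max 1 (-Real.log ε₀ / c) := lt_max_of_lt_left one_pos
    constructor
    · intro ht
      have ht0 : t < 0 := by linarith
      obtain ⟨ε, k, h0, h1, h2, h3, -⟩ := hmain (by rw [abs_of_neg ht0]; linarith)
      obtain ⟨hM, hu⟩ := h₁ s ε x t k h0 (h1.trans (hle s).1) (h3 ht0)
      exact ⟨hM, hu.trans (mul_le_mul (hCle s).1 h2 h0 ((hC₁ s).trans (hCle s).1))⟩
    · intro ht
      have ht0 : 0 < t := by linarith
      obtain ⟨ε, k, h0, h1, h2, -, h3⟩ := hmain (by rw [abs_of_pos ht0]; exact ht)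
      obtain ⟨hM, hu⟩ := h₂ s ε x t k h0 (h1.trans (hle s).2) (h3 ht0)
      exact ⟨hM, hu.trans (mul_le_mul (hCle s).2 h2 h0 ((hC₁ s).trans (hCle s).1))⟩
  · have hne := DarkSolitonData.minor_ne_zero hd hinj (Finset.Iio k)
    rw [p.cauchyDet_eq_minor, p.cauchyDet_eq_minor, DarkSolitonData.map_castLEEmb_val,
      DarkSolitonData.map_castLEEmb_val_add_one]
    refine ⟨hne, ?_⟩
    rw [DarkSolitonData.minor_insert hd (by simp), mul_div_cancel_left₀ _ hne,
      DarkSolitonData.interaction]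
    push_cast
    rfl
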